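/- Let $\mathbb K$ be an algebraically closed field of characteristic $0$, let $V$ be a vector space over $\mathbb K$ of finite positive dimension, and let $q\in\mathbb K$ be nonzero and not a root of unity. By an eigenspace of a linear map $T:V\to V$ we mean a nonzero subspace of the form $\{v\in V: Tv=\theta v\}$ with $\theta\in\mathbb K$; $T$ is diagonalizable if $V$ is spanned by the eigenspaces of $T$. For linear maps $T,S:V\to V$, an ordering $W_0,\dots,W_n$ of the eigenspaces of $T$ (each listed exactly once) is called standard with respect to $S$ if $SW_i\subseteq W_{i-1}+W_i+W_{i+1}$ for $0\le i\le n$, where $W_{-1}=W_{n+1}=0$. Let $A,A^*$ be a tridiagonal pair on $V$; that is, $A,A^*:V\to V$ are diagonalizable linear maps such that the eigenspaces of $A$ have an ordering that is standard with respect to $A^*$, the eigenspaces of $A^*$ have an ordering that is standard with respect to $A$, and there is no subspace $W$ with $AW\subseteq W$, $A^*W\subseteq W$, $W\ne0$, $W\ne V$. (Here $A^*$ is not the conjugate transpose or adjoint of $A$.) Assume that $$[A,\;A^2A^*-\beta AA^*A+A^*A^2-\gamma(AA^*+A^*A)-\varrho A^*]=0,$$ $$[A^*,\;A^{*2}A-\beta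 A^*AA^*+AA^{*2}-\gamma^*(A^*A+AA^*)-\varrho^*A]=0,$$ with $\beta=q^2+q^{-2}$ and $\gamma=\gamma^*=\varrho=\varrho^*=0$, where $[r,s]=rs-sr$ (equivalently, $A,A^*$ satisfy the $q$-Serre relations $A^3A^*-[3]A^2A^*A+[3]AA^*A^2-A^*A^3=0$ and $A^{*3}A-[3]A^{*2}AA^*+[3]A^*AA^{*2}-AA^{*3}=0$, where $[3]=q^2+1+q^{-2}$). Let $V_0,\dots,V_d$ be an ordering of the eigenspaces of $A$ that is standard with respect to $A^*$, and let $V_0^*,\dots,V_\delta^*$ be an ordering of the eigenspaces of $A^*$ that is standard with respect to $A$. Then $d=\delta$, the spaces $V_i$ and $V_i^*$ have the same dimension $\rho_i$ for $0\le i\le d$ (so that $(\rho_0,\dots,\rho_d)$ is the shape vector of $A,A^*$), and $$\rho_i\le\binom{d}{i}\qquad(0\le i\le d).$$ -/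

import Mathlib

namespace TridiagonalPair

open Module

variable {K V : Type*} [Field K] [AddCommGroup V] [Module K V]

/-- `W` is an eigenspace of `A`: it is nonzero and of the form `{v | A v = θ v}`. -/
def IsEigenspace (A : End K V) (W : Submodule K V) : Prop :=
  W ≠ ⊥ ∧ ∃ θ : K, W = End.eigenspace A θ

/-- `A` is diagonalizable: `V` is spanned by the eigenspaces of `A`. -/
def IsDiagonalizable (A : End K V) : Prop :=
  ⨆ θ : K, End.eigenspace A θ = ⊤

/-- `E 0, …, E d` is a standard ordering of the eigenspaces of `A` with respect to `B`:
it lists every eigenspace of `A` exactly once, and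
`B (E i) ⊆ E (i - 1) + E i + E (i + 1)` for all `i`, where `E (-1) = E (d + 1) = 0`. -/
structure IsStandardOrdering (A B : End K V) {d : ℕ} (E : Fin (d + 1) → Submodule K V) :
    Prop where
  injective : Function.Injective E
  range_eq : Set.range E = {W | IsEigenspace A W}
  map_le : ∀ i : Fin (d + 1), (E i).map B ≤
    ⨆ j : {j : Fin (d + 1) // (i : ℕ) ≤ j + 1 ∧ (j : ℕ) ≤ i + 1}, E j

/-- The ordered pair `A, B` (with `B` in the role of `A*`) is a tridiagonal pair on `V`. -/
structure IsTridiagonalPair (A B : End K V) : Prop where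
  diagonalizable_left : IsDiagonalizable A
  diagonalizable_right : IsDiagonalizable B
  exists_ordering_left : ∃ (d : ℕ) (E : Fin (d + 1) → Submodule K V), IsStandardOrdering A B E
  exists_ordering_right : ∃ (d : ℕ) (E : Fin (d + 1) → Submodule K V), IsStandardOrdering B A E
  irreducible : ¬ ∃ W : Submodule K V, W.map A ≤ W ∧ W.map B ≤ W ∧ W ≠ ⊥ ∧ W ≠ ⊤

/-- The two tridiagonal relations for `A, B` with parameters `β, γ, γ*, ϱ, ϱ*`;
the bracket is the commutator `⁅r, s⁆ = r * s - s * r`. -/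
def TridiagonalRelations (A B : End K V) (β γ γs ϱ ϱs : K) : Prop :=
  ⁅A, A ^ 2 * B - β • (A * B * A) + B * A ^ 2 - γ • (A * B + B * A) - ϱ • B⁆ = 0 ∧
  ⁅B, B ^ 2 * A - β • (B * A * B) + A * B ^ 2 - γs • (B * A + A * B) - ϱs • A⁆ = 0

end TridiagonalPair

namespace TridiagonalPair

open Module

/-! Write p = q². The spaces U_i = (V*_0+…+V*_i) ∩ (V_i+…+V_d) decompose V, and irreducibility gives
dim U_i = dim V_i = dim V*_i. The q-Serre relations force the eigenvalues into geometric
progressions: up to replacing p by p⁻¹ and reversing an ordering, they are a·p^i on V_i and b·p^(-i)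
on V*_i. If κ acts on U_i as p^i, then R = A − aκ sends U_i to U_{i+1}, L = A* − bκ⁻¹ sends U_i to
U_{i-1}, and R, L still satisfy the q-Serre relations (`QSerre.of_add`).

The engine is `QSerre.isGeomSum` with `IsGeomSum.eq_zero`: for fixed b and n, x^a y^b x^(n-a) is, as
a function of a, a combination of geometric sequences with the 2b+1 ratios p^(-b), …, p^b, so any
2b+1 of these terms span all of them. It is used twice.

It shows that the operators L^i R^i commute on U_0 (`IsRaisingLowering.comm_apply`), so they have a
common eigenvector v in U_0. Irreducibility makes V the span of the alternating words …L^j R^i v.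

It also straightens words (`IsRaisingLowering.dual_wordVec_eq_zero`): those whose exponents strictly
increase from left to right, within 1, …, d, suffice. These correspond to the subsets of {1, …, d},
and exactly binom(d, i) of them lie in U_i (`countP_zigzag`). -/

/-- The first `n + 1` terms of `f` are a linear combination of the geometric sequences with
ratios `s, s * p, …, s * p ^ (m - 1)`. -/
def IsGeomSum {K : Type*} [Field K] (p s : K) (m n : ℕ) (f : ℕ → K) : Prop :=
  ∃ Z : ℕ → K, ∀ a ≤ n, f a = ∑ k ∈ Finset.range m, (s * p ^ k) ^ a * Z k

/-! ### Sums of geometric sequences with consecutive ratios. -/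

section Sequences

variable {K : Type*} [Field K] {p s : K} {m n : ℕ} {f g : ℕ → K}

theorem IsGeomSum.congr (hf : IsGeomSum p s m n f) (h : ∀ a ≤ n, g a = f a) :
    IsGeomSum p s m n g := by
  obtain ⟨Z, hZ⟩ := hf
  exact ⟨Z, fun a ha => (h a ha).trans (hZ a ha)⟩

theorem IsGeomSum.sub (hf : IsGeomSum p s m n f) (hg : IsGeomSum p s m n g) :
    IsGeomSum p s m n (fun a => f a - g a) := by
  obtain ⟨Z, hZ⟩ := hf
  obtain ⟨Y, hY⟩ := hg
  refine ⟨fun k => Z k - Y k, fun a ha => ?_⟩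
  simp only [hZ a ha, hY a ha, mul_sub, Finset.sum_sub_distrib]

/-- The ratios p^(-b), …, p^b are permuted by inversion. -/
theorem IsGeomSum.reverse (hp0 : p ≠ 0) {b : ℕ} (hf : IsGeomSum p (p⁻¹ ^ b) (2 * b + 1) n f) :
    IsGeomSum p (p⁻¹ ^ b) (2 * b + 1) n (fun a => f (n - a)) := by
  obtain ⟨Z, hZ⟩ := hf
  refine ⟨fun k => (p⁻¹ ^ b * p ^ (2 * b - k)) ^ n * Z (2 * b - k), fun a ha => ?_⟩
  simp only [hZ (n - a) (Nat.sub_le n a)]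
  rw [← Finset.sum_range_reflect]
  refine Finset.sum_congr rfl fun k hk => ?_
  have hk : k ≤ 2 * b := by simp at hk; omega
  rw [← mul_assoc, show 2 * b + 1 - 1 - k = 2 * b - k by omega]
  congr 1
  have h1 : (p⁻¹ ^ b * p ^ k) * (p⁻¹ ^ b * p ^ (2 * b - k)) = 1 := by
    have : p ^ k * p ^ (2 * b - k) = p ^ b * p ^ b := by
      rw [← pow_add, ← pow_add]; congr 1; omega
    calc _ = (p⁻¹ ^ b * p⁻¹ ^ b) * (p ^ k * p ^ (2 * b - k)) := by ring
      _ = (p⁻¹ * p) ^ b * (p⁻¹ * p) ^ b := by rw [this]; ring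
      _ = 1 := by simp [hp0]
  obtain ⟨c, rfl⟩ := Nat.exists_eq_add_of_le ha
  rw [Nat.add_sub_cancel_left, pow_add, ← mul_assoc, ← mul_pow, h1, one_pow, one_mul]

/-- Here f a = s^a Q(p^a) for a polynomial Q of degree less than m, and the points p^a are distinct
because p is not a root of unity. -/
theorem IsGeomSum.eq_zero (hp0 : p ≠ 0) (hp : ∀ n : ℕ, 0 < n → p ^ n ≠ 1) (hs : s ≠ 0)
    (hf : IsGeomSum p s m n f) (T : Finset ℕ) (hT : ∀ a ∈ T, a ≤ n) (hcard : m ≤ T.card)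
    (h0 : ∀ a ∈ T, f a = 0) : ∀ a ≤ n, f a = 0 := by
  obtain ⟨Z, hZ⟩ := hf
  set Q : Polynomial K := ∑ k ∈ Finset.range m, Polynomial.C (Z k) * Polynomial.X ^ k with hQ
  have heval : ∀ a ≤ n, f a = s ^ a * Q.eval (p ^ a) := by
    intro a ha
    rw [hZ a ha, hQ, Polynomial.eval_finsetSum, Finset.mul_sum]
    refine Finset.sum_congr rfl fun k _ => ?_
    simp only [Polynomial.eval_mul, Polynomial.eval_C, Polynomial.eval_pow, Polynomial.eval_X]
    ring
  have hinj : Function.Injective (fun a : ℕ => p ^ a) := by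
    have key : ∀ a b : ℕ, a ≤ b → p ^ a = p ^ b → a = b := by
      intro a b hab h
      obtain ⟨c, rfl⟩ := Nat.exists_eq_add_of_le hab
      by_contra hne
      refine hp c (by omega) ?_
      rw [pow_add] at h
      exact (mul_right_eq_self₀.1 h.symm).resolve_right (pow_ne_zero _ hp0)
    intro a b h
    rcases le_total a b with hab | hab
    · exact key a b hab h
    · exact (key b a hab h.symm).symm
  have hQ0 : Q = 0 := by
    refine Polynomial.eq_zero_of_degree_lt_of_eval_index_eq_zero T (v := fun a : ℕ => p ^ a)
      hinj.injOn ?_ ?_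
    · refine lt_of_lt_of_le ?_ (Nat.cast_le.2 hcard)
      rw [← Polynomial.mem_degreeLT]
      refine Submodule.sum_mem _ fun k hk => Polynomial.mem_degreeLT.2 ?_
      exact (Polynomial.degree_C_mul_X_pow_le k (Z k)).trans_lt
        (Nat.cast_lt.2 (Finset.mem_range.1 hk))
    · intro a ha
      have := heval a (hT a ha)
      rw [h0 a ha] at this
      exact (mul_eq_zero.1 this.symm).resolve_left (pow_ne_zero _ hs)
  intro a ha
  rw [heval a ha, hQ0, Polynomial.eval_zero, mul_zero]

/-- This solves a first-order recurrence. There is no resonance, since s differs from every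
s·p^(k+1); the homogeneous solution s^a is fitted to f 0. -/
theorem IsGeomSum.of_sub (hp : ∀ n : ℕ, 0 < n → p ^ n ≠ 1) (hs : s ≠ 0)
    (h : ∃ Z : ℕ → K, ∀ a < n, f (a + 1) - s * f a =
      ∑ k ∈ Finset.range m, (s * p * p ^ k) ^ a * Z k) : IsGeomSum p s (m + 1) n f := by
  obtain ⟨Z, hZ⟩ := h
  have hne : ∀ k, s * p ^ (k + 1) - s ≠ 0 := by
    intro k hk
    apply hp (k + 1) (Nat.succ_pos k)
    have : s * (p ^ (k + 1) - 1) = 0 := by linear_combination hk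
    exact sub_eq_zero.1 ((mul_eq_zero.1 this).resolve_left hs)
  set Y : ℕ → K := fun k => Z k / (s * p ^ (k + 1) - s) with hY
  have hYZ : ∀ k, Z k = (s * p ^ (k + 1) - s) * Y k := fun k => by
    rw [hY, mul_comm, div_mul_cancel₀ _ (hne k)]
  refine ⟨fun k => Nat.casesOn k (f 0 - ∑ k ∈ Finset.range m, Y k) Y, fun a => ?_⟩
  simp only [Finset.sum_range_succ' _ m]
  induction a with
  | zero => intro _; simp
  | succ a ih =>
    intro ha
    have h1 := hZ a (by omega)
    have h2 := ih (by omega)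
    have h3 : f (a + 1) = s * f a + ∑ k ∈ Finset.range m, (s * p * p ^ k) ^ a * Z k := by
      rw [← h1]; ring
    rw [h3, h2, mul_add, Finset.mul_sum, add_right_comm, ← Finset.sum_add_distrib]
    congr 1
    · refine Finset.sum_congr rfl fun k _ => ?_
      simp only [hYZ k]
      ring
    · simp only [pow_zero, mul_one]; ring

end Sequences

/-! ### The q-Serre relation as iterated q-commutation. -/

/-- Iterated vanishing of `q`-commutators with `x`: `u` is annihilated by the product of the
operators `u ↦ x * u - s * p ^ k • (u * x)` for `k < m`. -/
def QNil {K 𝒜 : Type*} [Field K] [Ring 𝒜] [Algebra K 𝒜] (p : K) (x : 𝒜) : ℕ → K → 𝒜 → Prop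
  | 0, _, u => u = 0
  | m + 1, s, u => QNil p x m (s * p) (x * u - s • (u * x))

/-- The cubic `q`-Serre relation, with `p = q ^ 2`. -/
def QSerre {K 𝒜 : Type*} [Field K] [Ring 𝒜] [Algebra K 𝒜] (p : K) (x y : 𝒜) : Prop :=
  x * x * x * y - (p + 1 + p⁻¹) • (x * x * y * x) + (p + 1 + p⁻¹) • (x * y * x * x)
    - y * x * x * x = 0

section Serre

variable {K 𝒜 : Type*} [Field K] [Ring 𝒜] [Algebra K 𝒜] {p : K} {x y : 𝒜}

theorem QNil.zero (m : ℕ) (s : K) : QNil p x m s (0 : 𝒜) := by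
  induction m generalizing s with
  | zero => rfl
  | succ m ih => simpa [QNil] using ih (s * p)

theorem QNil.add {m : ℕ} {s : K} {u w : 𝒜} (hu : QNil p x m s u) (hw : QNil p x m s w) :
    QNil p x m s (u + w) := by
  induction m generalizing s u w with
  | zero => simp only [QNil] at *; simp [hu, hw]
  | succ m ih =>
    have := ih hu hw
    simp only [QNil] at *
    convert this using 1
    simp only [mul_add, add_mul, smul_add]; abel

theorem QNil.smul {m : ℕ} {s : K} {u : 𝒜} (c : K) (hu : QNil p x m s u) :
    QNil p x m s (c • u) := by
  induction m generalizing s u with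
  | zero => simp only [QNil] at *; simp [hu]
  | succ m ih =>
    have := ih hu
    simp only [QNil] at *
    convert this using 1
    rw [smul_sub, mul_smul_comm, smul_mul_assoc, smul_comm]

/-- A twisted Leibniz rule, x(uw) − st(uw)x = (xu − s·ux)w + s·u(xw − t·wx), drives an induction on
m + k. -/
theorem QNil.mul {m k : ℕ} {s t : K} {u w : 𝒜} (hu : QNil p x m s u) (hw : QNil p x k t w) :
    QNil p x (m + k - 1) (s * t) (u * w) := by
  induction hN : m + k using Nat.strong_induction_on generalizing m k s t u w with
  | _ N ih =>
  subst hN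
  rcases m with _ | m
  · simp only [QNil] at hu
    rw [hu, zero_mul]
    exact QNil.zero _ _
  rcases k with _ | k
  · simp only [QNil] at hw
    rw [hw, mul_zero]
    exact QNil.zero _ _
  rw [show m + 1 + (k + 1) - 1 = m + k + 1 by omega]
  simp only [QNil] at hu hw ⊢
  have h1 := ih (m + (k + 1)) (by omega) hu (show QNil p x (k + 1) t w from hw) rfl
  have h2 := ih (m + 1 + k) (by omega) (show QNil p x (m + 1) s u from hu) hw rfl
  rw [show m + (k + 1) - 1 = m + k by omega, show s * p * t = s * t * p by ring] at h1
  rw [show m + 1 + k - 1 = m + k by omega, show s * (t * p) = s * t * p by ring] at h2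
  convert h1.add (h2.smul s) using 1
  simp only [mul_sub, sub_mul, smul_sub, mul_smul_comm, smul_mul_assoc, smul_smul, mul_assoc]
  abel

theorem QSerre.qNil (hp0 : p ≠ 0) (h : QSerre p x y) : QNil p x 3 p⁻¹ y := by
  simp only [QNil, QSerre] at *
  rw [inv_mul_cancel₀ hp0, one_mul, one_smul, ← h]
  simp only [mul_sub, sub_mul, smul_sub, mul_smul_comm, smul_mul_assoc, smul_smul, mul_assoc,
    mul_inv_cancel₀ hp0, one_smul, add_smul]
  abel

theorem QSerre.qNil_pow (hp0 : p ≠ 0) (h : QSerre p x y) (b : ℕ) :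
    QNil p x (2 * b + 1) (p⁻¹ ^ b) (y ^ b) := by
  induction b with
  | zero => simp [QNil]
  | succ b ih => exact (pow_succ p⁻¹ b) ▸ (pow_succ y b) ▸ ih.mul (h.qNil hp0)

theorem QNil.isGeomSum (hp0 : p ≠ 0) (hp : ∀ n : ℕ, 0 < n → p ^ n ≠ 1) {m : ℕ} {s : K}
    (hs : s ≠ 0) {u : 𝒜} (hu : QNil p x m s u) (n : ℕ) (φ : Dual K 𝒜) :
    IsGeomSum p s m n (fun a => φ (x ^ a * u * x ^ (n - a))) := by
  induction m generalizing s u n with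
  | zero =>
    simp only [QNil] at hu
    exact ⟨0, fun a _ => by simp [hu]⟩
  | succ m ih =>
    refine IsGeomSum.of_sub hp hs ?_
    rcases n with _ | n
    · exact ⟨0, fun a ha => absurd ha (by omega)⟩
    obtain ⟨Z, hZ⟩ := ih (mul_ne_zero hs hp0) hu n
    refine ⟨Z, fun a ha => ?_⟩
    have key : x ^ (a + 1) * u * x ^ (n + 1 - (a + 1)) - s • (x ^ a * u * x ^ (n + 1 - a)) =
        x ^ a * (x * u - s • (u * x)) * x ^ (n - a) := by
      rw [show n + 1 - (a + 1) = n - a by omega, show n + 1 - a = (n - a) + 1 by omega, pow_succ,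
        pow_succ' x (n - a)]
      simp only [mul_sub, sub_mul, mul_smul_comm, smul_mul_assoc, mul_assoc]
    rw [← hZ a (by omega)]
    dsimp only
    rw [← key, map_sub, map_smul, smul_eq_mul]

theorem QSerre.isGeomSum (hp0 : p ≠ 0) (hp : ∀ n : ℕ, 0 < n → p ^ n ≠ 1) (h : QSerre p x y)
    (b n : ℕ) (φ : Dual K 𝒜) :
    IsGeomSum p (p⁻¹ ^ b) (2 * b + 1) n (fun a => φ (x ^ a * y ^ b * x ^ (n - a))) :=
  (h.qNil_pow hp0 b).isGeomSum hp0 hp (pow_ne_zero _ (inv_ne_zero hp0)) n φ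

end Serre

/-! ### Commuting operators in degree 0 and their common eigenvector. -/

/-- `R` raises and `L` lowers the degree of the family `U`, which vanishes in degrees outside
`0, …, d`. -/
structure IsRaisingLowering {K V : Type*} [Field K] [AddCommGroup V] [Module K V]
    (d : ℕ) (U : ℤ → Submodule K V) (R L : End K V) : Prop where
  raise : ∀ i, ∀ x ∈ U i, R x ∈ U (i + 1)
  lower : ∀ i, ∀ x ∈ U i, L x ∈ U (i - 1)
  eq_bot_of_neg : ∀ i < 0, U i = ⊥
  eq_bot_of_lt : ∀ i : ℤ, (d : ℤ) < i → U i = ⊥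

section Graded

variable {K V : Type*} [Field K] [AddCommGroup V] [Module K V] {d : ℕ} {U : ℤ → Submodule K V}
  {R L : End K V} {p : K}

theorem IsRaisingLowering.raise_pow (h : IsRaisingLowering d U R L) {i : ℤ} {x : V} (hx : x ∈ U i)
    (k : ℕ) : (R ^ k) x ∈ U (i + k) := by
  induction k with
  | zero => simpa using hx
  | succ k ih =>
    rw [pow_succ', Module.End.mul_apply]
    have := h.raise _ _ ih
    rwa [add_assoc, ← Nat.cast_succ] at this

theorem IsRaisingLowering.lower_pow (h : IsRaisingLowering d U R L) {i : ℤ} {x : V} (hx : x ∈ U i)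
    (k : ℕ) : (L ^ k) x ∈ U (i - k) := by
  induction k with
  | zero => simpa using hx
  | succ k ih =>
    rw [pow_succ', Module.End.mul_apply]
    have := h.lower _ _ ih
    rwa [sub_sub, ← Nat.cast_succ] at this

theorem IsRaisingLowering.lower_pow_raise_pow_eq_zero (h : IsRaisingLowering d U R L) {x : V}
    (hx : x ∈ U 0) {j i : ℕ} (hij : i < j) : (L ^ j) ((R ^ i) x) = 0 := by
  have := h.lower_pow (h.raise_pow hx i) j
  rwa [h.eq_bot_of_neg _ (by omega), Submodule.mem_bot] at this

theorem IsRaisingLowering.lower_pow_raise_pow_mem (h : IsRaisingLowering d U R L) {x : V}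
    (hx : x ∈ U 0) (i : ℕ) : (L ^ i) ((R ^ i) x) ∈ U 0 := by
  simpa using h.lower_pow (h.raise_pow hx i) i

theorem IsRaisingLowering.comm_apply (h : IsRaisingLowering d U R L) (hp0 : p ≠ 0)
    (hp : ∀ n : ℕ, 0 < n → p ^ n ≠ 1) (hRL : QSerre p R L) (hLR : QSerre p L R) {w : V}
    (hw : w ∈ U 0) (i j : ℕ) :
    (L ^ i) ((R ^ i) ((L ^ j) ((R ^ j) w))) = (L ^ j) ((R ^ j) ((L ^ i) ((R ^ i) w))) := by
  wlog hij : i ≤ j generalizing i j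
  · exact (this j i (le_of_not_ge hij)).symm
  rw [← sub_eq_zero, ← Module.forall_dual_apply_eq_zero_iff K]
  intro ψ
  rw [map_sub]
  set n := i + j with hn
  let f : ℕ → ℕ → ℕ → ℕ → K := fun a b c e => ψ ((L ^ a) ((R ^ b) ((L ^ c) ((R ^ e) w))))
  -- In a, both terms are geometric sums with the ratios p^(-b), …, p^b. Their difference is killed
  -- at 2b+1 points: for a < b both terms vanish by degree, at a = n − b they coincide, and for a >
  -- n − b the claim is the one for n − a < b with the two terms exchanged.
  have key : ∀ b, 2 * b ≤ n → ∀ a ≤ n, f a b (n - a) (n - b) - f (n - b) (n - a) b a = 0 := by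
    intro b
    induction b using Nat.strong_induction_on with
    | _ b ih =>
    intro hb
    have h1 := hLR.isGeomSum hp0 hp b n
      ((ψ ∘ₗ LinearMap.applyₗ w) ∘ₗ LinearMap.mulRight K (R ^ (n - b)))
    have h2 := (hRL.isGeomSum hp0 hp b n
      ((ψ ∘ₗ LinearMap.applyₗ w) ∘ₗ LinearMap.mulLeft K (L ^ (n - b)))).reverse hp0
    have h3 := (h1.sub h2).congr
      (g := fun a => f a b (n - a) (n - b) - f (n - b) (n - a) b a) (by
        intro a ha
        simp only [LinearMap.comp_apply, LinearMap.applyₗ_apply_apply, LinearMap.mulRight_apply,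
          LinearMap.mulLeft_apply, Module.End.mul_apply, Nat.sub_sub_self ha, f])
    refine h3.eq_zero hp0 hp (pow_ne_zero _ (inv_ne_zero hp0))
      (Finset.range b ∪ Finset.Icc (n - b) n) ?_ ?_ ?_
    · intro a ha
      simp only [Finset.mem_union, Finset.mem_range, Finset.mem_Icc] at ha
      omega
    · rw [Finset.card_union_of_disjoint, Finset.card_range, Nat.card_Icc]
      · omega
      · rw [Finset.disjoint_left]
        intro a ha ha'
        simp only [Finset.mem_range, Finset.mem_Icc] at ha ha'
        omega
    · intro a ha
      simp only [Finset.mem_union, Finset.mem_range, Finset.mem_Icc] at ha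
      rcases ha with ha | ⟨ha, ha'⟩
      · simp only [f]
        rw [h.lower_pow_raise_pow_eq_zero hw ha, h.lower_pow_raise_pow_eq_zero hw
          (show n - b < n - a by omega)]
        simp
      · rcases ha.eq_or_lt with rfl | ha
        · rw [Nat.sub_sub_self (by omega), sub_self]
        · have := ih (n - a) (by omega) (by omega) (n - b) (by omega)
          rw [Nat.sub_sub_self (by omega), Nat.sub_sub_self ha'] at this
          rw [← neg_sub, this, neg_zero]
  have := key i (by omega) i (by omega)
  rwa [show n - i = j by omega] at this

theorem IsRaisingLowering.exists_common_eigenvector [IsAlgClosed K] [FiniteDimensional K V]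
    (h : IsRaisingLowering d U R L) (hp0 : p ≠ 0) (hp : ∀ n : ℕ, 0 < n → p ^ n ≠ 1)
    (hRL : QSerre p R L) (hLR : QSerre p L R) (h0 : U 0 ≠ ⊥) :
    ∃ v ∈ U 0, v ≠ 0 ∧ ∀ i : ℕ, ∃ c : K, (L ^ i) ((R ^ i) v) = c • v := by
  have key : ∀ k : ℕ, ∃ c : ℕ → K, ∃ v ∈ U 0, v ≠ 0 ∧ ∀ i < k, (L ^ i) ((R ^ i) v) = c i • v := by
    intro k
    induction k with
    | zero =>
      obtain ⟨v, hv, hv0⟩ := Submodule.exists_mem_ne_zero_of_ne_bot h0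
      exact ⟨0, v, hv, hv0, fun i hi => absurd hi (Nat.not_lt_zero i)⟩
    | succ k ih =>
      obtain ⟨c, v, hv, hv0, hc⟩ := ih
      let W : Submodule K V := U 0 ⊓ ⨅ i : ℕ, ⨅ _ : i < k, End.eigenspace (L ^ i * R ^ i) (c i)
      have hW : ∀ x, x ∈ W ↔ x ∈ U 0 ∧ ∀ i < k, (L ^ i) ((R ^ i) x) = c i • x := by
        intro x
        simp only [W, Submodule.mem_inf, Submodule.mem_iInf, End.mem_eigenspace_iff,
          Module.End.mul_apply]
      have hmap : ∀ x ∈ W, (L ^ k * R ^ k) x ∈ W := by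
        intro x hx
        rw [hW] at hx ⊢
        refine ⟨h.lower_pow_raise_pow_mem hx.1 k, fun i hi => ?_⟩
        rw [Module.End.mul_apply, h.comm_apply hp0 hp hRL hLR hx.1, hx.2 i hi]
        simp only [map_smul]
      have : Nontrivial W := ⟨⟨⟨v, (hW v).2 ⟨hv, hc⟩⟩, 0, fun e => hv0 (by simpa using e)⟩⟩
      obtain ⟨μ, hμ⟩ := Module.End.exists_eigenvalue ((L ^ k * R ^ k).restrict hmap)
      obtain ⟨⟨x, hxW⟩, hx⟩ := hμ.exists_hasEigenvector
      have hxe : (L ^ k) ((R ^ k) x) = μ • x := congrArg Subtype.val hx.apply_eq_smul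
      refine ⟨Function.update c k μ, x, ((hW x).1 hxW).1, fun e => hx.2 (by simp [e]), ?_⟩
      intro i hi
      rcases (Nat.lt_succ_iff.1 hi).eq_or_lt with rfl | hik
      · rw [Function.update_self, hxe]
      · rw [Function.update_of_ne hik.ne, ((hW x).1 hxW).2 i hik]
  -- Exponents 0, …, d suffice, because R^i v = 0 for i > d.
  obtain ⟨c, v, hv, hv0, hc⟩ := key (d + 1)
  refine ⟨v, hv, hv0, fun i => ?_⟩
  rcases lt_or_ge i (d + 1) with hi | hi
  · exact ⟨c i, hc i hi⟩
  · have := h.raise_pow hv i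
    rw [h.eq_bot_of_lt _ (by omega), Submodule.mem_bot] at this
    exact ⟨0, by rw [this, map_zero, zero_smul]⟩

end Graded

/-! ### Alternating words and the combinatorics of their exponents. -/

/-- The letter in position `k`, counted from the right, of an alternating word ending in `R`. -/
def letter {K V : Type*} [Field K] [AddCommGroup V] [Module K V] (R L : End K V) (k : ℕ) :
    End K V := if Even k then R else L

/-- The operator `… L ^ i R ^ j …` with exponents `l`, which is followed by `k` further powers. -/
def wordOp {K V : Type*} [Field K] [AddCommGroup V] [Module K V] (R L : End K V) (k : ℕ) :
    List ℕ → End K V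
  | [] => 1
  | i :: l => letter R L (l.length + k) ^ i * wordOp R L k l

/-- The vector `… L ^ i R ^ j v`, where `[…, i, j]` is the given list of exponents. -/
def wordVec {K V : Type*} [Field K] [AddCommGroup V] [Module K V] (R L : End K V) (v : V) :
    List ℕ → V
  | [] => v
  | i :: l => (letter R L l.length ^ i) (wordVec R L v l)

/-- The degree of `… L ^ i R ^ j v` when `v` has degree `0`. -/
def wordDegree : List ℕ → ℤ
  | [] => 0
  | i :: l => if Even l.length then wordDegree l + i else wordDegree l - i

/-- The sum of the squares of the exponents. -/
def sqSum : List ℕ → ℕ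
  | [] => 0
  | i :: l => i ^ 2 + sqSum l

/-- The sum of the exponents, weighted by their positions. -/
def posSum : List ℕ → ℕ
  | [] => 0
  | _ :: l => posSum l + l.sum

/-- The strictly increasing lists of exponents in `1, …, d`. -/
def zigzag : ℕ → List (List ℕ)
  | 0 => [[]]
  | d + 1 => zigzag d ++ (zigzag d).map (· ++ [d + 1])

section Lists

theorem sqSum_append (l₁ l₂ : List ℕ) : sqSum (l₁ ++ l₂) = sqSum l₁ + sqSum l₂ := by
  induction l₁ with
  | nil => simp [sqSum]
  | cons a l ih => simp [sqSum, ih, add_assoc]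

theorem posSum_append (l₁ l₂ : List ℕ) :
    posSum (l₁ ++ l₂) = posSum l₁ + posSum l₂ + l₁.length * l₂.sum := by
  induction l₁ with
  | nil => simp [posSum]
  | cons a l ih => simp [posSum, ih]; ring

theorem sqSum_le (l : List ℕ) : sqSum l ≤ l.sum ^ 2 := by
  induction l with
  | nil => simp [sqSum]
  | cons a l ih => simp only [sqSum, List.sum_cons]; nlinarith [Nat.zero_le (a * l.sum)]

theorem wordDegree_append_singleton (l : List ℕ) (m : ℕ) :
    wordDegree (l ++ [m]) = m - wordDegree l := by
  induction l with
  | nil => simp [wordDegree]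
  | cons a l ih =>
    simp only [List.cons_append, wordDegree, ih, List.length_append, List.length_cons,
      List.length_nil, Nat.even_add_one, zero_add]
    split_ifs <;> ring

/-- The ascent of the last two entries propagates to the left. -/
theorem isChain_lt_of_no_valley {l : List ℕ}
    (htail : ∀ l₁ j i, l = l₁ ++ [j, i] → j < i)
    (hvalley : ∀ l₁ a b c l₂, l = l₁ ++ a :: b :: c :: l₂ → b < c → a < b) :
    l.IsChain (· < ·) := by
  induction l with
  | nil => exact List.IsChain.nil
  | cons x l ih =>
    have ih := ih (fun l₁ j i h => htail (x :: l₁) j i (by simp [h]))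
      (fun l₁ a b c l₂ h => hvalley (x :: l₁) a b c l₂ (by simp [h]))
    match l, ih with
    | [], _ => exact List.IsChain.singleton x
    | [y], ih => exact List.IsChain.cons_cons (htail [] x y rfl) ih
    | y :: z :: t, ih =>
      exact List.IsChain.cons_cons
        (hvalley [] x y z t rfl (List.isChain_cons_cons.1 ih).1) ih

theorem mem_zigzag {d : ℕ} {l : List ℕ} (hl : l.Pairwise (· < ·)) (hpos : ∀ x ∈ l, 0 < x)
    (hle : ∀ x ∈ l, x ≤ d) : l ∈ zigzag d := by
  induction d generalizing l with
  | zero =>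
    match l with
    | [] => simp [zigzag]
    | x :: l => exact absurd (hpos x (by simp)) (by have := hle x (by simp); omega)
  | succ d ih =>
    rw [zigzag, List.mem_append]
    rcases l.eq_nil_or_concat' with rfl | ⟨l', m, rfl⟩
    · exact Or.inl (ih hl hpos (by simp))
    have hlt := (List.pairwise_append.1 hl).2.2
    have hm := hle m (by simp)
    have hd : ∀ x ∈ l', x ≤ d := fun x hx => by
      have := hlt x hx m (by simp)
      omega
    rcases hm.eq_or_lt with rfl | hm
    · refine Or.inr (List.mem_map.2 ⟨l', ih (List.pairwise_append.1 hl).1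
        (fun x hx => hpos x (by simp [hx])) hd, rfl⟩)
    · refine Or.inl (ih hl hpos fun x hx => ?_)
      rcases List.mem_append.1 hx with hx | hx
      · exact hd x hx
      · rw [List.mem_singleton.1 hx]; omega

theorem wordDegree_mem_of_mem_zigzag {d : ℕ} {l : List ℕ} (hl : l ∈ zigzag d) :
    0 ≤ wordDegree l ∧ wordDegree l ≤ d := by
  induction d generalizing l with
  | zero =>
    simp only [zigzag, List.mem_singleton] at hl
    simp [hl, wordDegree]
  | succ d ih =>
    rw [zigzag, List.mem_append, List.mem_map] at hl
    rcases hl with hl | ⟨l', hl', rfl⟩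
    · have := ih hl
      push_cast
      omega
    · have := ih hl'
      rw [wordDegree_append_singleton]
      push_cast
      omega

/-- Appending d + 1 turns degree z into d + 1 − z, so the recursion is Pascal's rule combined with
the symmetry of binomial coefficients. -/
theorem countP_zigzag (d i : ℕ) :
    (zigzag d).countP (fun l => wordDegree l = i) = d.choose i := by
  have hzero : ∀ (d : ℕ) (z : ℤ), z < 0 ∨ (d : ℤ) < z →
      (zigzag d).countP (fun l => wordDegree l = z) = 0 := by
    intro d z hz
    rw [List.countP_eq_zero]
    intro l hl
    have := wordDegree_mem_of_mem_zigzag hl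
    simp only [decide_eq_true_eq]
    omega
  induction d generalizing i with
  | zero =>
    rcases i with _ | i
    · simp [zigzag, wordDegree]
    · rw [hzero _ _ (by right; push_cast; omega), Nat.choose_zero_succ]
  | succ d ih =>
    rw [zigzag, List.countP_append, List.countP_map, ih]
    have : (zigzag d).countP ((fun l => decide (wordDegree l = (i : ℤ))) ∘ (· ++ [d + 1])) =
        (zigzag d).countP (fun l => wordDegree l = (d + 1 - i : ℤ)) := by
      refine List.countP_congr fun l _ => ?_
      simp only [Function.comp_apply, wordDegree_append_singleton, decide_eq_true_eq]
      push_cast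
      omega
    rw [this]
    rcases i with _ | i
    · rw [hzero _ _ (by right; push_cast; omega)]
      simp
    · rw [Nat.choose_succ_succ, add_comm]
      congr 1
      rcases le_or_gt i d with hi | hi
      · rw [show ((d : ℤ) + 1 - ((i + 1 : ℕ) : ℤ)) = ((d - i : ℕ) : ℤ) by omega, ih,
          Nat.choose_symm hi]
      · rw [hzero _ _ (by left; push_cast; omega), Nat.choose_eq_zero_of_lt hi]

end Lists

/-! ### Straightening words and bounding the graded dimensions. -/

section Words

variable {K V : Type*} [Field K] [AddCommGroup V] [Module K V] {d : ℕ} {U : ℤ → Submodule K V}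
  {R L : End K V} {p : K} {v : V}

theorem wordVec_append (l₁ l₂ : List ℕ) :
    wordVec R L v (l₁ ++ l₂) = wordOp R L l₂.length l₁ (wordVec R L v l₂) := by
  induction l₁ with
  | nil => simp [wordOp]
  | cons a l ih => simp [wordVec, wordOp, ih]

theorem letter_add_two (k : ℕ) : letter R L (k + 2) = letter R L k := by
  simp only [letter, Nat.even_add, even_two, iff_true]

theorem qSerre_letter (hRL : QSerre p R L) (hLR : QSerre p L R) (k : ℕ) :
    QSerre p (letter R L k) (letter R L (k + 1)) := by
  by_cases hk : Even k <;> simp [letter, hk, Nat.even_add_one, hRL, hLR]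

theorem IsRaisingLowering.wordVec_mem (h : IsRaisingLowering d U R L) (hv : v ∈ U 0)
    (l : List ℕ) : wordVec R L v l ∈ U (wordDegree l) := by
  induction l with
  | nil => exact hv
  | cons i l ih =>
    by_cases hl : Even l.length
    · simpa [wordVec, wordDegree, letter, hl] using h.raise_pow ih i
    · simpa [wordVec, wordDegree, letter, hl] using h.lower_pow ih i

theorem letter_wordVec_mem_span (k : ℕ) (l : List ℕ) :
    letter R L k (wordVec R L v l) ∈ Submodule.span K (Set.range (wordVec R L v)) := by
  by_cases hk : Even k ↔ Even l.length
  · refine Submodule.subset_span ⟨1 :: l, ?_⟩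
    simp [wordVec, letter, hk]
  · match l with
    | [] =>
      -- The rightmost letter must be R, so L v is written as L^1 R^0 v.
      refine Submodule.subset_span ⟨[1, 0], ?_⟩
      have : ¬ Even k := by simpa using hk
      simp [wordVec, letter, this]
    | i :: l =>
      refine Submodule.subset_span ⟨(i + 1) :: l, ?_⟩
      have : Even k ↔ Even l.length := by
        simp only [List.length_cons, Nat.even_add_one] at hk
        tauto
      by_cases hl : Even l.length <;> simp [wordVec, letter, this, hl, pow_succ']

/-- This is the spanning statement in dual form, which allows `IsGeomSum.eq_zero` to be applied to
scalars. The induction is lexicographic: length, then `l.sum ^ 2 - sqSum l`, then `posSum l`. -/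
theorem IsRaisingLowering.dual_wordVec_eq_zero (h : IsRaisingLowering d U R L) (hp0 : p ≠ 0)
    (hp : ∀ n : ℕ, 0 < n → p ^ n ≠ 1) (hRL : QSerre p R L) (hLR : QSerre p L R) (hv : v ∈ U 0)
    (hc : ∀ i : ℕ, ∃ c : K, (L ^ i) ((R ^ i) v) = c • v) (φ : Dual K V)
    (hφ : ∀ l ∈ zigzag d, φ (wordVec R L v l) = 0) (l : List ℕ) : φ (wordVec R L v l) = 0 := by
  induction hn : l.length using Nat.strong_induction_on generalizing l with
  | _ n ihn =>
  induction hm : l.sum ^ 2 - sqSum l using Nat.strong_induction_on generalizing l with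
  | _ m ihm =>
  induction ht : posSum l using Nat.strong_induction_on generalizing l with
  | _ t iht =>
  by_cases hvalley : ∀ l₁ a b c l₂, l = l₁ ++ a :: b :: c :: l₂ → b < c → a < b
  swap
  · push Not at hvalley
    obtain ⟨l₁, a, b, c, l₂, rfl, hbc, hba⟩ := hvalley
    have key : ∀ x y, wordVec R L v (l₁ ++ x :: b :: y :: l₂) =
        (wordOp R L (l₂.length + 3) l₁ * (letter R L l₂.length ^ x *
          letter R L (l₂.length + 1) ^ b * letter R L l₂.length ^ y)) (wordVec R L v l₂) := by
      intro x y
      rw [wordVec_append]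
      simp only [wordVec, List.length_cons, Module.End.mul_apply]
      rw [show l₂.length + 1 + 1 = l₂.length + 2 from rfl, letter_add_two]
    have hz := ((qSerre_letter hRL hLR l₂.length).isGeomSum hp0 hp b (a + c)
      ((φ ∘ₗ LinearMap.applyₗ (wordVec R L v l₂)) ∘ₗ
        LinearMap.mulLeft K (wordOp R L (l₂.length + 3) l₁))).congr
      (g := fun x => φ (wordVec R L v (l₁ ++ x :: b :: (a + c - x) :: l₂))) (by
        intro x _
        rw [key]
        rfl)
    have hz := hz.eq_zero hp0 hp (pow_ne_zero _ (inv_ne_zero hp0))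
      -- These are 2b+1 points: the two ranges are disjoint since b ≤ a and b < c give 2b < a + c.
      (Finset.range b ∪ Finset.Icc (a + c - b) (a + c)) ?_ ?_ ?_ a (by omega)
    · rwa [Nat.add_sub_cancel_left] at hz
    · intro x hx
      simp only [Finset.mem_union, Finset.mem_range, Finset.mem_Icc] at hx
      omega
    · rw [Finset.card_union_of_disjoint, Finset.card_range, Nat.card_Icc]
      · omega
      · rw [Finset.disjoint_left]
        intro x hx hx'
        simp only [Finset.mem_range, Finset.mem_Icc] at hx hx'
        omega
    · intro x hx
      simp only [Finset.mem_union, Finset.mem_range, Finset.mem_Icc] at hx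
      obtain ⟨y, hy⟩ : ∃ y, x + y = a + c := ⟨a + c - x, by omega⟩
      rw [show a + c - x = y by omega]
      have hlen : (l₁ ++ x :: b :: y :: l₂).length = n := by rw [← hn]; simp
      have hsum : (l₁ ++ x :: b :: y :: l₂).sum = (l₁ ++ a :: b :: c :: l₂).sum := by
        simp only [List.sum_append, List.sum_cons]
        omega
      by_cases hsq : a ^ 2 + c ^ 2 < x ^ 2 + y ^ 2
      · refine ihm _ ?_ _ hlen rfl
        have hle := sqSum_le (l₁ ++ x :: b :: y :: l₂)
        have hlt : sqSum (l₁ ++ a :: b :: c :: l₂) < sqSum (l₁ ++ x :: b :: y :: l₂) := by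
          simp only [sqSum_append, sqSum]
          omega
        rw [← hm, hsum]
        rw [hsum] at hle
        omega
      -- With x + y = a + c, one has x² + y² − a² − c² = 2(a − x)(c − x). At the chosen points this
      -- is positive, except possibly when x = c.
      · have hprod : (a - x : ℤ) * (c - x) = 0 ∨ (a - x : ℤ) * (c - x) < 0 := by
          by_contra hcon
          push Not at hcon
          have hpos : (0 : ℤ) < (a - x : ℤ) * (c - x) := lt_of_le_of_ne hcon.2 (Ne.symm hcon.1)
          apply hsq
          zify at hy ⊢
          have : (y : ℤ) = a + c - x := by linarith
          rw [this]
          nlinarith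
        have hxy : x = c ∧ y = a := by
          rcases hx with hx | hx
          · exfalso
            have h1 : (0 : ℤ) < a - x := by omega
            have h2 : (0 : ℤ) < c - x := by omega
            have := mul_pos h1 h2
            omega
          · have h1 : (c - x : ℤ) ≤ 0 := by omega
            have h2 : (a - x : ℤ) < 0 := by omega
            rcases h1.eq_or_lt with h1 | h1
            · omega
            · have := mul_pos_of_neg_of_neg h2 h1
              omega
        obtain ⟨rfl, rfl⟩ := hxy
        -- The two outer exponents are exchanged: the squares are unchanged, but the larger exponent
        -- moves left, which lowers `posSum`.
        refine iht _ ?_ _ hlen ?_ rfl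
        · rw [← ht]
          simp only [posSum_append, posSum, List.sum_cons]
          have : x + (b + (y + l₂.sum)) = y + (b + (x + l₂.sum)) := by ring
          rw [this]
          omega
        · rw [← hm, hsum]
          congr 1
          simp only [sqSum_append, sqSum]
          ring
  by_cases htail : ∀ l₁ j i, l = l₁ ++ [j, i] → j < i
  swap
  · push Not at htail
    obtain ⟨l₁, j, i, rfl, hij⟩ := htail
    have hw : wordVec R L v [j, i] = (L ^ j) ((R ^ i) v) := by simp [wordVec, letter]
    rw [wordVec_append, hw]
    rcases hij.eq_or_lt with rfl | hij
    -- L^i R^i v is a multiple of v, so two exponents drop out; the parity of the remaining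
    -- positions is unchanged.
    · obtain ⟨c, hc⟩ := hc i
      have heven : wordOp R L ([i, i] : List ℕ).length l₁ v = wordVec R L v l₁ := by
        clear ihn ihm iht hvalley hm hn ht
        induction l₁ with
        | nil => rfl
        | cons a l ih =>
          simp only [wordOp, wordVec, Module.End.mul_apply, ih]
          rw [show l.length + ([i, i] : List ℕ).length = l.length + 2 from rfl, letter_add_two]
      rw [hc, map_smul, map_smul, heven, ihn l₁.length (by rw [← hn]; simp) l₁ rfl, smul_zero]
    · rw [h.lower_pow_raise_pow_eq_zero hv hij, map_zero, map_zero]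
  have hpw := List.isChain_iff_pairwise.1 (isChain_lt_of_no_valley htail hvalley)
  by_cases hpos : ∀ x ∈ l, 0 < x
  · rcases l.eq_nil_or_concat' with rfl | ⟨l', k, rfl⟩
    · exact hφ [] (mem_zigzag hpw hpos (by simp))
    rcases le_or_gt k d with hk | hk
    · refine hφ _ (mem_zigzag hpw hpos fun x hx => ?_)
      rcases List.mem_append.1 hx with hx | hx
      · have := (List.pairwise_append.1 hpw).2.2 x hx k (by simp)
        omega
      · rw [List.mem_singleton.1 hx]
        exact hk
    · have : wordVec R L v [k] = 0 := by
        have hk' := h.raise_pow hv k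
        rw [h.eq_bot_of_lt _ (by omega), Submodule.mem_bot] at hk'
        simpa [wordVec, letter] using hk'
      rw [wordVec_append, this, map_zero, map_zero]
  · match l with
    | [] => simp at hpos
    | x :: l' =>
      have hx : x = 0 := by
        by_contra hx
        apply hpos
        intro y hy
        rcases List.mem_cons.1 hy with rfl | hy
        · omega
        · have := (List.pairwise_cons.1 hpw).1 y hy
          omega
      subst hx
      simpa [wordVec] using ihn l'.length (by rw [← hn]; simp) l' rfl

theorem IsRaisingLowering.finrank_le_choose [IsAlgClosed K] [FiniteDimensional K V]
    (h : IsRaisingLowering d U R L) (hp0 : p ≠ 0) (hp : ∀ n : ℕ, 0 < n → p ^ n ≠ 1)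
    (hRL : QSerre p R L) (hLR : QSerre p L R) (h0 : U 0 ≠ ⊥) (hind : iSupIndep U)
    (hirr : ∀ s : Set V, (∀ x ∈ s, ∃ i, x ∈ U i) → (∀ x ∈ s, R x ∈ Submodule.span K s) →
      (∀ x ∈ s, L x ∈ Submodule.span K s) → (∃ x ∈ s, x ≠ 0) → Submodule.span K s = ⊤) (i : ℕ) :
    finrank K (U i) ≤ d.choose i := by
  obtain ⟨v, hv, hv0, hc⟩ := h.exists_common_eigenvector hp0 hp hRL hLR h0
  have hspan : Submodule.span K (Set.range (wordVec R L v)) = ⊤ := by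
    refine hirr _ ?_ ?_ ?_ ⟨v, ⟨[], rfl⟩, hv0⟩
    · rintro _ ⟨l, rfl⟩
      exact ⟨_, h.wordVec_mem hv l⟩
    · rintro _ ⟨l, rfl⟩
      exact letter_wordVec_mem_span 0 l
    · rintro _ ⟨l, rfl⟩
      simpa [letter] using letter_wordVec_mem_span (R := R) (L := L) (v := v) 1 l
  classical
  let W : ℤ → Submodule K V := fun j => Submodule.span K
    ((((zigzag d).filter fun l => wordDegree l = j).map (wordVec R L v)).toFinset : Set V)
  have hWU : W ≤ U := by
    intro j
    refine Submodule.span_le.2 ?_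
    intro x hx
    simp only [List.coe_toFinset, List.mem_map, List.mem_filter, Set.mem_ofPred_eq,
      decide_eq_true_eq] at hx
    obtain ⟨l, ⟨_, rfl⟩, rfl⟩ := hx
    exact h.wordVec_mem hv l
  have hW : ⨆ j, W j = ⊤ := by
    by_contra hne
    obtain ⟨φ, hφ, hle⟩ := Submodule.exists_le_ker_of_lt_top _ (lt_top_iff_ne_top.2 hne)
    apply hφ
    have hall := h.dual_wordVec_eq_zero hp0 hp hRL hLR hv hc φ (by
      intro l hl
      refine hle (Submodule.mem_iSup_of_mem (wordDegree l) (Submodule.subset_span ?_))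
      simp only [List.coe_toFinset, List.mem_map, List.mem_filter, Set.mem_ofPred_eq,
        decide_eq_true_eq]
      exact ⟨l, ⟨hl, rfl⟩, rfl⟩)
    have : (⊤ : Submodule K V) ≤ LinearMap.ker φ := by
      rw [← hspan, Submodule.span_le]
      rintro _ ⟨l, rfl⟩
      exact hall l
    exact LinearMap.ker_eq_top.1 (top_le_iff.1 this)
  -- Subspaces of independent summands that together span V must fill the summands.
  have hWU' : W = U := (hind.le_iff_eq_of_iSup_eq_top hW).1 hWU
  rw [← hWU', ← countP_zigzag d i, List.countP_eq_length_filter]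
  refine (finrank_span_finset_le_card _).trans ((List.toFinset_card_le _).trans ?_)
  simp

end Words

/-! ### Flags and the split decomposition. -/

/-- The sum of the `E j` with `i ≤ j`. -/
def upFlag {K V : Type*} [Field K] [AddCommGroup V] [Module K V] {d : ℕ}
    (E : Fin (d + 1) → Submodule K V) (i : ℤ) : Submodule K V :=
  ⨆ j ∈ {j : Fin (d + 1) | i ≤ (j : ℕ)}, E j

/-- The sum of the `E j` with `j ≤ i`. -/
def downFlag {K V : Type*} [Field K] [AddCommGroup V] [Module K V] {d : ℕ}
    (E : Fin (d + 1) → Submodule K V) (i : ℤ) : Submodule K V :=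
  ⨆ j ∈ {j : Fin (d + 1) | ((j : ℕ) : ℤ) ≤ i}, E j

/-- The intersection of the two flags; for `i = j` these are the components of the split
decomposition. -/
def splitSpace {K V : Type*} [Field K] [AddCommGroup V] [Module K V] {d δ : ℕ}
    (E : Fin (d + 1) → Submodule K V) (F : Fin (δ + 1) → Submodule K V) (i j : ℤ) :
    Submodule K V :=
  downFlag F i ⊓ upFlag E j

section Flags

variable {K V : Type*} [Field K] [AddCommGroup V] [Module K V] {d δ : ℕ} {A B : End K V}
  {E : Fin (d + 1) → Submodule K V} {F : Fin (δ + 1) → Submodule K V} {θ η : ℤ → K}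

theorem le_upFlag {j : Fin (d + 1)} {i : ℤ} (h : i ≤ (j : ℕ)) : E j ≤ upFlag E i :=
  le_iSup₂_of_le j h le_rfl

theorem le_downFlag {j : Fin (d + 1)} {i : ℤ} (h : ((j : ℕ) : ℤ) ≤ i) : E j ≤ downFlag E i :=
  le_iSup₂_of_le j h le_rfl

theorem upFlag_le {W : Submodule K V} {i : ℤ} (h : ∀ j : Fin (d + 1), i ≤ (j : ℕ) → E j ≤ W) :
    upFlag E i ≤ W :=
  iSup₂_le h

theorem downFlag_le {W : Submodule K V} {i : ℤ}
    (h : ∀ j : Fin (d + 1), ((j : ℕ) : ℤ) ≤ i → E j ≤ W) : downFlag E i ≤ W :=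
  iSup₂_le h

theorem upFlag_anti {i j : ℤ} (h : i ≤ j) : upFlag E j ≤ upFlag E i :=
  upFlag_le fun _ hk => le_upFlag (h.trans hk)

theorem downFlag_mono {i j : ℤ} (h : i ≤ j) : downFlag E i ≤ downFlag E j :=
  downFlag_le fun _ hk => le_downFlag (hk.trans h)

theorem upFlag_eq_bot {i : ℤ} (h : (d : ℤ) < i) : upFlag E i = ⊥ :=
  eq_bot_iff.2 (upFlag_le fun j hj => absurd hj (by have := j.2; omega))

theorem downFlag_eq_bot {i : ℤ} (h : i < 0) : downFlag E i = ⊥ :=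
  eq_bot_iff.2 (downFlag_le fun j hj => absurd hj (by omega))

theorem upFlag_sub_mem (hθ : ∀ j : Fin (d + 1), E j = End.eigenspace A (θ (j : ℕ))) {i : ℤ}
    {x : V} (hx : x ∈ upFlag E i) : A x - θ i • x ∈ upFlag E (i + 1) := by
  have : upFlag E i ≤ (upFlag E (i + 1)).comap (A - θ i • 1) := by
    refine upFlag_le fun j hj y hy => ?_
    have hAy : A y = θ (j : ℕ) • y := by rwa [hθ, End.mem_eigenspace_iff] at hy
    simp only [Submodule.mem_comap, LinearMap.sub_apply, LinearMap.smul_apply,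
      Module.End.one_apply, hAy, ← sub_smul]
    rcases hj.eq_or_lt with rfl | hj
    · simp
    · exact Submodule.smul_mem _ _ (le_upFlag (j := j) (by omega) hy)
  simpa using this hx

theorem downFlag_sub_mem (hθ : ∀ j : Fin (d + 1), E j = End.eigenspace A (θ (j : ℕ))) {i : ℤ}
    {x : V} (hx : x ∈ downFlag E i) : A x - θ i • x ∈ downFlag E (i - 1) := by
  have : downFlag E i ≤ (downFlag E (i - 1)).comap (A - θ i • 1) := by
    refine downFlag_le fun j hj y hy => ?_
    have hAy : A y = θ (j : ℕ) • y := by rwa [hθ, End.mem_eigenspace_iff] at hy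
    simp only [Submodule.mem_comap, LinearMap.sub_apply, LinearMap.smul_apply,
      Module.End.one_apply, hAy, ← sub_smul]
    rcases hj.eq_or_lt with rfl | hj
    · simp
    · exact Submodule.smul_mem _ _ (le_downFlag (j := j) (by omega) hy)
  simpa using this hx

theorem IsStandardOrdering.upFlag_map (hE : IsStandardOrdering A B E) {i : ℤ} {x : V}
    (hx : x ∈ upFlag E i) : B x ∈ upFlag E (i - 1) := by
  have : upFlag E i ≤ (upFlag E (i - 1)).comap B := by
    refine upFlag_le fun j hj => Submodule.map_le_iff_le_comap.1 ((hE.map_le j).trans ?_)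
    exact iSup_le fun k => le_upFlag (by have := k.2; omega)
  exact this hx

theorem IsStandardOrdering.downFlag_map (hE : IsStandardOrdering A B E) {i : ℤ} {x : V}
    (hx : x ∈ downFlag E i) : B x ∈ downFlag E (i + 1) := by
  have : downFlag E i ≤ (downFlag E (i + 1)).comap B := by
    refine downFlag_le fun j hj => Submodule.map_le_iff_le_comap.1 ((hE.map_le j).trans ?_)
    exact iSup_le fun k => le_downFlag (by have := k.2; omega)
  exact this hx

theorem IsStandardOrdering.ne_bot (hE : IsStandardOrdering A B E) (j : Fin (d + 1)) :
    E j ≠ ⊥ := by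
  have : E j ∈ {W | IsEigenspace A W} := hE.range_eq ▸ Set.mem_range_self j
  exact this.1

theorem IsStandardOrdering.exists_eigenvalues (hE : IsStandardOrdering A B E) :
    ∃ θ : ℕ → K, ∀ j : Fin (d + 1), E j = End.eigenspace A (θ j) := by
  have : ∀ j, ∃ t, E j = End.eigenspace A t := fun j => by
    have : E j ∈ {W | IsEigenspace A W} := hE.range_eq ▸ Set.mem_range_self j
    exact this.2
  choose t ht using this
  refine ⟨fun k => if h : k < d + 1 then t ⟨k, h⟩ else 0, fun j => ?_⟩
  simp only [ht j, j.2, dif_pos]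

theorem IsStandardOrdering.iSupIndep (hE : IsStandardOrdering A B E) : iSupIndep E := by
  obtain ⟨θ, hθ⟩ := hE.exists_eigenvalues
  have hinj : Function.Injective fun j : Fin (d + 1) => θ j := fun i j hij =>
    hE.injective (by rw [hθ i, hθ j]; exact congrArg _ hij)
  have := (Module.End.eigenspaces_iSupIndep A).comp hinj
  convert this using 1
  exact funext hθ

theorem IsStandardOrdering.iSup_eq_top (hE : IsStandardOrdering A B E)
    (hA : IsDiagonalizable A) : ⨆ j, E j = ⊤ := by
  rw [eq_top_iff, ← hA]
  refine iSup_le fun t => ?_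
  by_cases ht : End.eigenspace A t = ⊥
  · rw [ht]; exact bot_le
  · have : End.eigenspace A t ∈ Set.range E := by
      rw [hE.range_eq]
      exact ⟨ht, t, rfl⟩
    obtain ⟨j, hj⟩ := this
    exact hj ▸ le_iSup E j

theorem IsStandardOrdering.isCompl_flags (hE : IsStandardOrdering A B E)
    (hA : IsDiagonalizable A) (i : ℤ) : IsCompl (downFlag E i) (upFlag E (i + 1)) := by
  constructor
  · refine hE.iSupIndep.disjoint_biSup_biSup ?_
    rw [Set.disjoint_left]
    intro j hj hj'
    simp only [Set.mem_ofPred_eq] at hj hj'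
    omega
  · rw [codisjoint_iff, eq_top_iff, ← hE.iSup_eq_top hA]
    refine iSup_le fun j => ?_
    rcases le_or_gt ((j : ℕ) : ℤ) i with hj | hj
    · exact (le_downFlag hj).trans le_sup_left
    · exact (le_upFlag (by omega)).trans le_sup_right

theorem finrank_sup_of_disjoint [FiniteDimensional K V] {S T : Submodule K V}
    (h : Disjoint S T) : finrank K ↥(S ⊔ T) = finrank K S + finrank K T := by
  rw [← Submodule.finrank_sup_add_finrank_inf_eq, h.eq_bot, finrank_bot, add_zero]

theorem IsStandardOrdering.finrank_flags [FiniteDimensional K V] (hE : IsStandardOrdering A B E)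
    (hA : IsDiagonalizable A) (i : ℤ) :
    finrank K (downFlag E i) + finrank K (upFlag E (i + 1)) = finrank K V := by
  rw [← finrank_sup_of_disjoint (hE.isCompl_flags hA i).disjoint,
    (hE.isCompl_flags hA i).sup_eq_top, finrank_top]

theorem IsStandardOrdering.finrank_downFlag [FiniteDimensional K V]
    (hE : IsStandardOrdering A B E) (j : Fin (d + 1)) :
    finrank K (downFlag E ((j : ℕ) : ℤ)) =
      finrank K (E j) + finrank K (downFlag E (((j : ℕ) : ℤ) - 1)) := by
  have h : downFlag E ((j : ℕ) : ℤ) = E j ⊔ downFlag E (((j : ℕ) : ℤ) - 1) := by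
    refine le_antisymm (downFlag_le fun k hk => ?_)
      (sup_le (le_downFlag le_rfl) (downFlag_mono (by omega)))
    rcases hk.eq_or_lt with hk | hk
    · rw [show k = j from Fin.ext (by omega)]
      exact le_sup_left
    · exact (le_downFlag (by omega)).trans le_sup_right
  rw [h, finrank_sup_of_disjoint]
  refine hE.iSupIndep.disjoint_biSup ?_
  simp

theorem splitSpace_sub_mem (hF : IsStandardOrdering B A F)
    (hθ : ∀ j : Fin (d + 1), E j = End.eigenspace A (θ (j : ℕ))) {i j : ℤ} {x : V}
    (hx : x ∈ splitSpace E F i j) : A x - θ j • x ∈ splitSpace E F (i + 1) (j + 1) :=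
  ⟨Submodule.sub_mem _ (hF.downFlag_map hx.1)
    (Submodule.smul_mem _ _ (downFlag_mono (by omega) hx.1)), upFlag_sub_mem hθ hx.2⟩

theorem splitSpace_sub_mem' (hE : IsStandardOrdering A B E)
    (hη : ∀ j : Fin (δ + 1), F j = End.eigenspace B (η (j : ℕ))) {i j : ℤ} {x : V}
    (hx : x ∈ splitSpace E F i j) : B x - η i • x ∈ splitSpace E F (i - 1) (j - 1) :=
  ⟨downFlag_sub_mem hη hx.1, Submodule.sub_mem _ (hE.upFlag_map hx.2)
    (Submodule.smul_mem _ _ (upFlag_anti (by omega) hx.2))⟩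

theorem IsTridiagonalPair.swap (h : IsTridiagonalPair A B) : IsTridiagonalPair B A :=
  ⟨h.diagonalizable_right, h.diagonalizable_left, h.exists_ordering_right,
    h.exists_ordering_left, fun ⟨W, h1, h2, h3⟩ => h.irreducible ⟨W, h2, h1, h3⟩⟩

theorem IsTridiagonalPair.eq_bot_or_eq_top (h : IsTridiagonalPair A B) {W : Submodule K V}
    (hA : ∀ x ∈ W, A x ∈ W) (hB : ∀ x ∈ W, B x ∈ W) : W = ⊥ ∨ W = ⊤ := by
  by_contra hcon
  push Not at hcon
  refine h.irreducible ⟨W, ?_, ?_, hcon.1, hcon.2⟩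
  · rintro _ ⟨x, hx, rfl⟩
    exact hA x hx
  · rintro _ ⟨x, hx, rfl⟩
    exact hB x hx

/-- Along each diagonal, A and B act as scalars on each component, up to a shift by ±1, so the sum
is invariant. -/
theorem IsTridiagonalPair.iSup_splitSpace (h : IsTridiagonalPair A B)
    (hE : IsStandardOrdering A B E) (hF : IsStandardOrdering B A F) (r : ℤ) :
    ⨆ i : ℤ, splitSpace E F i (i + r) = ⊥ ∨ ⨆ i : ℤ, splitSpace E F i (i + r) = ⊤ := by
  obtain ⟨θ, hθ⟩ := hE.exists_eigenvalues
  obtain ⟨η, hη⟩ := hF.exists_eigenvalues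
  refine h.eq_bot_or_eq_top ?_ ?_
  · have : ⨆ i : ℤ, splitSpace E F i (i + r) ≤
        (⨆ i : ℤ, splitSpace E F i (i + r)).comap A := by
      refine iSup_le fun i x hx => ?_
      have h1 := splitSpace_sub_mem (θ := fun k => θ k.toNat) hF (by simpa using hθ) hx
      rw [add_right_comm] at h1
      have h2 := Submodule.mem_iSup_of_mem (p := fun i : ℤ => splitSpace E F i (i + r)) (i + 1) h1
      have h3 := Submodule.mem_iSup_of_mem (p := fun i : ℤ => splitSpace E F i (i + r)) i hx
      simpa using Submodule.add_mem _ h2 (Submodule.smul_mem _ (θ (i + r).toNat) h3)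
    exact fun x hx => this hx
  · have : ⨆ i : ℤ, splitSpace E F i (i + r) ≤
        (⨆ i : ℤ, splitSpace E F i (i + r)).comap B := by
      refine iSup_le fun i x hx => ?_
      have h1 := splitSpace_sub_mem' (η := fun k => η k.toNat) hE (by simpa using hη) hx
      rw [show i + r - 1 = i - 1 + r by ring] at h1
      have h2 := Submodule.mem_iSup_of_mem (p := fun i : ℤ => splitSpace E F i (i + r)) (i - 1) h1
      have h3 := Submodule.mem_iSup_of_mem (p := fun i : ℤ => splitSpace E F i (i + r)) i hx
      simpa using Submodule.add_mem _ h2 (Submodule.smul_mem _ (η i.toNat) h3)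
    exact fun x hx => this hx

/-- The sum along a diagonal with j − i > 0 misses V_0, lying in V_1+…+V_d, so it is not V and
irreducibility makes it zero. -/
theorem IsTridiagonalPair.splitSpace_eq_bot (h : IsTridiagonalPair A B)
    (hE : IsStandardOrdering A B E) (hF : IsStandardOrdering B A F) {i j : ℤ} (hij : i < j) :
    splitSpace E F i j = ⊥ := by
  have hle : ∀ k : ℤ, splitSpace E F k (k + (j - i)) ≤ upFlag E (0 + 1) := by
    intro k
    rcases lt_or_ge k 0 with hk | hk
    · exact inf_le_left.trans ((downFlag_eq_bot hk).le.trans bot_le)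
    · exact inf_le_right.trans (upFlag_anti (by omega))
  rcases h.iSup_splitSpace hE hF (j - i) with h0 | h0
  · have := le_iSup (fun k : ℤ => splitSpace E F k (k + (j - i))) i
    rw [h0] at this
    simpa using this
  · have htop : upFlag E (0 + 1) = ⊤ := eq_top_iff.2 (h0 ▸ iSup_le hle)
    have hdisj := (hE.isCompl_flags h.diagonalizable_left 0).disjoint
    rw [htop, disjoint_top] at hdisj
    exact absurd (eq_bot_iff.2 (hdisj ▸ le_downFlag (E := E) (j := 0) (by simp))) (hE.ne_bot 0)

theorem IsTridiagonalPair.iSup_splitSpace_eq_top (h : IsTridiagonalPair A B)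
    (hE : IsStandardOrdering A B E) (hF : IsStandardOrdering B A F) :
    ⨆ i : ℤ, splitSpace E F i i = ⊤ := by
  have htop : upFlag E 0 = ⊤ := eq_top_iff.2
    ((hE.iSup_eq_top h.diagonalizable_left).symm.le.trans
      (iSup_le fun j => le_upFlag (by omega)))
  have := (h.iSup_splitSpace hE hF 0).resolve_left fun h0 => by
    have h1 := le_iSup (fun k : ℤ => splitSpace E F k (k + 0)) 0
    rw [h0, splitSpace, add_zero, htop, inf_top_eq] at h1
    exact hF.ne_bot 0 (eq_bot_iff.2 ((le_downFlag (by simp)).trans h1))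
  simpa using this

theorem IsTridiagonalPair.diameter_le (h : IsTridiagonalPair A B)
    (hE : IsStandardOrdering A B E) (hF : IsStandardOrdering B A F) : d ≤ δ := by
  by_contra hlt
  have h0 := h.splitSpace_eq_bot hE hF (i := δ) (j := d) (by omega)
  have htop : downFlag F δ = ⊤ := eq_top_iff.2
    ((hF.iSup_eq_top h.diagonalizable_right).symm.le.trans
      (iSup_le fun j => le_downFlag (by have := j.2; omega)))
  rw [splitSpace, htop, top_inf_eq] at h0
  exact hE.ne_bot (Fin.last d) (eq_bot_iff.2 (h0 ▸ le_upFlag (by simp)))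

/-- In a vanishing sum, the term of top index a also lies in the lower flag a − 1, hence in a zero
intersection. -/
theorem iSupIndep_splitSpace (h0 : ∀ i j : ℤ, i < j → splitSpace E F i j = ⊥) :
    iSupIndep fun i : ℤ => splitSpace E F i i := by
  rw [iSupIndep_iff_finsetSum_eq_zero_imp_eq_zero]
  intro s
  induction s using Finset.induction_on_max with
  | empty => simp
  | insert a s hs ih =>
    intro v hv hsum
    have ha : a ∉ s := fun h => lt_irrefl _ (hs a h)
    rw [Finset.sum_insert ha] at hsum
    have hva : v a = 0 := by
      have h1 : v a ∈ splitSpace E F (a - 1) a := by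
        refine ⟨?_, (hv a (by simp)).2⟩
        rw [eq_neg_of_add_eq_zero_left hsum]
        refine Submodule.neg_mem _ (Submodule.sum_mem _ fun i hi => ?_)
        exact downFlag_mono (by have := hs i hi; omega) (hv i (by simp [hi])).1
      rwa [h0 _ _ (by omega), Submodule.mem_bot] at h1
    rw [hva, zero_add] at hsum
    intro i hi
    rcases Finset.mem_insert.1 hi with rfl | hi
    · exact hva
    · exact ih v (fun j hj => hv j (by simp [hj])) hsum i hi

section Dimension

variable [FiniteDimensional K V]

/-- The lower flag of F meets trivially a complement of the lower flag of E. Exchanging A and B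
gives the reverse inequality. -/
theorem IsTridiagonalPair.finrank_downFlag_le (h : IsTridiagonalPair A B)
    (hE : IsStandardOrdering A B E) (hF : IsStandardOrdering B A F) (i : ℤ) :
    finrank K (downFlag F i) ≤ finrank K (downFlag E i) := by
  have h1 : Disjoint (downFlag F i) (upFlag E (i + 1)) :=
    disjoint_iff.2 (h.splitSpace_eq_bot hE hF (by omega))
  have h2 := finrank_sup_of_disjoint h1
  have h3 := Submodule.finrank_le (downFlag F i ⊔ upFlag E (i + 1))
  have h4 := hE.finrank_flags h.diagonalizable_left i
  omega

theorem IsTridiagonalPair.finrank_downFlag_eq (h : IsTridiagonalPair A B)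
    (hE : IsStandardOrdering A B E) (hF : IsStandardOrdering B A F) (i : ℤ) :
    finrank K (downFlag F i) = finrank K (downFlag E i) :=
  (h.finrank_downFlag_le hE hF i).antisymm (h.swap.finrank_downFlag_le hF hE i)

theorem IsTridiagonalPair.finrank_eq {F : Fin (d + 1) → Submodule K V}
    (h : IsTridiagonalPair A B) (hE : IsStandardOrdering A B E) (hF : IsStandardOrdering B A F)
    (j : Fin (d + 1)) : finrank K (F j) = finrank K (E j) := by
  have h1 := hE.finrank_downFlag j
  have h2 := hF.finrank_downFlag j
  rw [h.finrank_downFlag_eq hE hF, h.finrank_downFlag_eq hE hF] at h2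
  omega

/-- By dimension, the lower flag of F at k − 1 complements the upper flag of E at k. Enlarging the
former to k makes the intersection grow by dim E_k. -/
theorem IsTridiagonalPair.finrank_splitSpace (h : IsTridiagonalPair A B)
    (hE : IsStandardOrdering A B E) (hF : IsStandardOrdering B A F) (j : Fin (d + 1)) :
    finrank K (splitSpace E F ((j : ℕ) : ℤ) ((j : ℕ) : ℤ)) = finrank K (E j) := by
  set k : ℤ := ((j : ℕ) : ℤ) with hk
  have h1 : Disjoint (downFlag F (k - 1)) (upFlag E k) :=
    disjoint_iff.2 (h.splitSpace_eq_bot hE hF (by omega))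
  have h2 := finrank_sup_of_disjoint h1
  have h3 := hE.finrank_flags h.diagonalizable_left (k - 1)
  rw [sub_add_cancel] at h3
  rw [h.finrank_downFlag_eq hE hF, h3] at h2
  have h4 : downFlag F k ⊔ upFlag E k = ⊤ := eq_top_iff.2
    ((Submodule.eq_top_of_finrank_eq h2).symm.le.trans
      (sup_le_sup_right (downFlag_mono (by omega)) _))
  have h5 := Submodule.finrank_sup_add_finrank_inf_eq (downFlag F k) (upFlag E k)
  have h6 := hE.finrank_downFlag j
  rw [← hk] at h6
  rw [h4, finrank_top, h.finrank_downFlag_eq hE hF, h6] at h5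
  rw [splitSpace]
  omega

end Dimension

end Flags

/-! ### Removing the diagonal parts from the q-Serre relations. -/

section Algebra

variable {K 𝒜 : Type*} [Field K] [Ring 𝒜] [Algebra K 𝒜] {p : K}

theorem QSerre.inv {x y : 𝒜} (h : QSerre p x y) : QSerre p⁻¹ x y := by
  unfold QSerre at *
  rwa [inv_inv, show p⁻¹ + 1 + p = p + 1 + p⁻¹ by ring]

/-- The `q`-Serre relation is not affected by adding suitable `q`-commuting elements. -/
theorem QSerre.of_add (hp0 : p ≠ 0) {R L κ κ' : 𝒜} (a b : K) (hκ : κ * κ' = 1) (hκ' : κ' * κ = 1)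
    (hκR : κ * R = p • (R * κ)) (hκL : κ * L = p⁻¹ • (L * κ)) (hκ'R : κ' * R = p⁻¹ • (R * κ'))
    (h : QSerre p (R + a • κ) (L + b • κ')) : QSerre p R L := by
  -- R + aκ and κ' satisfy a q-Weyl relation, which implies the cubic relation. By linearity in the
  -- second argument the term bκ' can then be dropped; the terms in a cancel by q-commutation.
  have h1 : QSerre p (R + a • κ) κ' := by
    have hc : (R + a • κ) * κ' - p • (κ' * (R + a • κ)) = (a * (1 - p)) • 1 := by
      simp only [add_mul, mul_add, smul_mul_assoc, mul_smul_comm, hκ, hκ', hκ'R, smul_smul,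
        smul_add, mul_inv_cancel₀ hp0, one_smul]
      module
    generalize R + a • κ = x at hc ⊢
    have hx : x * κ' = p • (κ' * x) + (a * (1 - p)) • 1 := by rw [← hc]; abel
    have hx' : ∀ z, x * (κ' * z) = p • (κ' * (x * z)) + (a * (1 - p)) • z := fun z => by
      rw [← mul_assoc, hx, add_mul, smul_mul_assoc, smul_mul_assoc, one_mul, mul_assoc]
    simp only [QSerre, mul_assoc, hx, hx', mul_add, add_mul, mul_smul_comm,
      smul_mul_assoc, smul_add, smul_smul, mul_one, one_mul]
    match_scalars <;> field_simp <;> ring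
  have hκR' : ∀ z, κ * (R * z) = p • (R * (κ * z)) := fun z => by
    rw [← mul_assoc, hκR, smul_mul_assoc, mul_assoc]
  have hκL' : ∀ z, κ * (L * z) = p⁻¹ • (L * (κ * z)) := fun z => by
    rw [← mul_assoc, hκL, smul_mul_assoc, mul_assoc]
  unfold QSerre at *
  rw [← sub_eq_zero.2 (h.trans (smul_zero b).symm), ← h1]
  simp only [mul_assoc, mul_add, add_mul, smul_mul_assoc, mul_smul_comm, smul_add, smul_smul,
    hκR, hκL, hκR', hκL', smul_sub]
  match_scalars <;> field_simp <;> ring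

end Algebra

/-! ### Geometric eigenvalues, reversed orderings and diagonal operators. -/

section Eigenvalues

variable {K V : Type*} [Field K] [AddCommGroup V] [Module K V] {d δ : ℕ} {A B : End K V}
  {E : Fin (d + 1) → Submodule K V} {F : Fin (δ + 1) → Submodule K V} {p : K}

/-- Switching between the ratios p and p⁻¹ would repeat a value. -/
theorem geometric_of_ratio {t : ℕ → K} {d : ℕ} (hp0 : p ≠ 0)
    (hstep : ∀ k < d, t (k + 1) = p * t k ∨ t (k + 1) = p⁻¹ * t k)
    (hinj : ∀ i ≤ d, ∀ j ≤ d, t i = t j → i = j) :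
    (∀ k ≤ d, t k = t 0 * p ^ k) ∨ (∀ k ≤ d, t k = t 0 * p⁻¹ ^ k) := by
  induction d with
  | zero => exact Or.inl fun k hk => by simp [Nat.le_zero.1 hk]
  | succ d ih =>
    have extend : ∀ r : K, (∀ k ≤ d, t k = t 0 * r ^ k) → t (d + 1) = r * t d →
        ∀ k ≤ d + 1, t k = t 0 * r ^ k := by
      intro r hr hd k hk
      rcases hk.eq_or_lt with rfl | hk
      · rw [hd, hr d le_rfl]; ring
      · exact hr k (by omega)
    have back : ∀ r : K, r ≠ 0 → (∀ k ≤ d, t k = t 0 * r ^ k) → t (d + 1) = r⁻¹ * t d →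
        d = 0 := by
      intro r hr0 hr hd
      by_contra hne
      obtain ⟨e, rfl⟩ := Nat.exists_eq_succ_of_ne_zero hne
      have : t (e + 1 + 1) = t e := by
        rw [hd, hr (e + 1) le_rfl, hr e (by omega), pow_succ]
        field_simp
      have := hinj _ le_rfl _ (by omega) this
      omega
    rcases ih (fun k hk => hstep k (by omega))
      (fun i hi j hj => hinj i (by omega) j (by omega)) with h | h
    · rcases hstep d (by omega) with hd | hd
      · exact Or.inl (extend p h hd)
      · obtain rfl := back p hp0 h hd
        exact Or.inr (extend p⁻¹ (fun k hk => by simp [Nat.le_zero.1 hk]) hd)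
    · rcases hstep d (by omega) with hd | hd
      · obtain rfl := back p⁻¹ (inv_ne_zero hp0) h (by rwa [inv_inv])
        exact Or.inl (extend p (fun k hk => by simp [Nat.le_zero.1 hk]) hd)
      · exact Or.inr (extend p⁻¹ h hd)

theorem IsTridiagonalPair.eigenvalue_ratio (h : IsTridiagonalPair A B) (hp0 : p ≠ 0)
    (hrel : QSerre p A B) (hE : IsStandardOrdering A B E) {θ : ℕ → K}
    (hθ : ∀ j : Fin (d + 1), E j = End.eigenspace A (θ j)) {k : ℕ} (hk : k < d) :
    θ (k + 1) = p * θ k ∨ θ (k + 1) = p⁻¹ * θ k := by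
  set D := downFlag E (k : ℤ) with hD
  obtain ⟨η, hη⟩ : ∃ η : ℤ → K, ∀ i : ℕ, η i = θ i := ⟨fun i => θ i.toNat, fun i => by simp⟩
  have hθ' : ∀ j : Fin (d + 1), E j = End.eigenspace A (η (j : ℕ)) := by
    simpa only [hη] using hθ
  have hAD : ∀ x ∈ D, A x ∈ D := by
    intro x hx
    have h1 : A x - η k • x ∈ D :=
      downFlag_mono (show (k : ℤ) - 1 ≤ k by omega) (downFlag_sub_mem hθ' hx)
    simpa using D.add_mem h1 (D.smul_mem (η k) hx)
  -- Otherwise D would be a proper nonzero invariant subspace.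
  obtain ⟨x, hx, hBx⟩ : ∃ x ∈ E ⟨k, by omega⟩, B x ∉ D := by
    by_contra hcon
    push Not at hcon
    have hBD : ∀ x ∈ D, B x ∈ D := by
      have : D ≤ D.comap B := by
        refine downFlag_le fun j hj y hy => ?_
        rcases hj.eq_or_lt with hj | hj
        · have hjk : j = ⟨k, by omega⟩ := Fin.ext (by simpa using hj)
          rw [hjk] at hy
          exact hcon y hy
        · exact downFlag_mono (show ((j : ℕ) : ℤ) + 1 ≤ k by omega)
            (hE.downFlag_map (le_downFlag le_rfl hy))
      exact fun x hx => this hx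
    rcases h.eq_bot_or_eq_top hAD hBD with h0 | h0
    · exact hE.ne_bot 0 (eq_bot_iff.2 (h0 ▸ le_downFlag (by simp)))
    · have := (hE.isCompl_flags h.diagonalizable_left k).disjoint
      rw [← hD, h0, top_disjoint] at this
      exact hE.ne_bot (Fin.last d) (eq_bot_iff.2 (this ▸ le_upFlag (by simp; omega)))
  have hAx : A x = θ k • x := by rwa [hθ, End.mem_eigenspace_iff] at hx
  have hne : θ (k + 1) ≠ θ k := by
    intro he
    have := hE.injective (a₁ := ⟨k + 1, by omega⟩) (a₂ := ⟨k, by omega⟩) (by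
      rw [hθ, hθ]; exact congrArg _ he)
    simp at this
  have h1 : A (B x) - θ (k + 1) • B x ∈ D := by
    have hx' : B x ∈ downFlag E ((k : ℤ) + 1) :=
      hE.downFlag_map (le_downFlag (j := ⟨k, by omega⟩) le_rfl hx)
    have := downFlag_sub_mem hθ' hx'
    rwa [add_sub_cancel_right, ← Nat.cast_add_one, hη] at this
  have h2 : A (A (B x)) - θ (k + 1) ^ 2 • B x ∈ D := by
    have := D.add_mem (hAD _ h1) (D.smul_mem (θ (k + 1)) h1)
    simp only [map_sub, map_smul] at this
    convert this using 1
    module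
  have h3 : A (A (A (B x))) - θ (k + 1) ^ 3 • B x ∈ D := by
    have := D.add_mem (hAD _ h2) (D.smul_mem (θ (k + 1) ^ 2) h1)
    simp only [map_sub, map_smul] at this
    convert this using 1
    module
  have hx0 := LinearMap.congr_fun hrel x
  simp only [LinearMap.sub_apply, LinearMap.add_apply, LinearMap.smul_apply,
    Module.End.mul_apply, hAx, map_smul, LinearMap.zero_apply] at hx0
  -- Modulo D, A acts on B x as θ (k + 1), so the q-Serre relation applied to x becomes a factored
  -- cubic times B x.
  have h4 : ((θ (k + 1) - θ k) * (θ (k + 1) - p * θ k) * (θ (k + 1) - p⁻¹ * θ k)) • B x ∈ D := by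
    have := D.sub_mem (D.sub_mem (D.smul_mem ((p + 1 + p⁻¹) * θ k) h2)
      (D.smul_mem ((p + 1 + p⁻¹) * θ k ^ 2) h1)) h3
    rw [← add_zero (_ - _ - _), ← hx0] at this
    convert this using 1
    match_scalars <;> field_simp <;> ring
  have h5 : (θ (k + 1) - θ k) * (θ (k + 1) - p * θ k) * (θ (k + 1) - p⁻¹ * θ k) = 0 := by
    by_contra hc
    exact hBx ((D.smul_mem_iff hc).1 h4)
  rcases mul_eq_zero.1 h5 with h5 | h5
  · rcases mul_eq_zero.1 h5 with h5 | h5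
    · exact absurd (sub_eq_zero.1 h5) hne
    · exact Or.inl (sub_eq_zero.1 h5)
  · exact Or.inr (sub_eq_zero.1 h5)

theorem IsTridiagonalPair.exists_geometric (h : IsTridiagonalPair A B) (hp0 : p ≠ 0)
    (hrel : QSerre p A B) (hE : IsStandardOrdering A B E) :
    ∃ a : K, (∀ j : Fin (d + 1), E j = End.eigenspace A (a * p ^ (j : ℕ))) ∨
      (∀ j : Fin (d + 1), E j = End.eigenspace A (a * p⁻¹ ^ (j : ℕ))) := by
  obtain ⟨θ, hθ⟩ := hE.exists_eigenvalues
  refine ⟨θ 0, ?_⟩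
  have := geometric_of_ratio (t := θ) (d := d) hp0
    (fun k hk => h.eigenvalue_ratio hp0 hrel hE hθ hk) (fun i hi j hj hij => by
      have := hE.injective (a₁ := ⟨i, by omega⟩) (a₂ := ⟨j, by omega⟩) (by
        rw [hθ, hθ]; exact congrArg _ hij)
      simpa using this)
  rcases this with h1 | h1
  · exact Or.inl fun j => by rw [hθ j, h1 j (by have := j.2; omega)]
  · exact Or.inr fun j => by rw [hθ j, h1 j (by have := j.2; omega)]

theorem IsStandardOrdering.rev (hE : IsStandardOrdering A B E) :
    IsStandardOrdering A B (E ∘ Fin.rev) where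
  injective := hE.injective.comp Fin.rev_injective
  range_eq := by rw [Fin.rev_surjective.range_comp, hE.range_eq]
  map_le i := (hE.map_le i.rev).trans <| iSup_le fun j => by
    refine le_iSup_of_le ⟨j.1.rev, ?_⟩ ?_
    · have := j.2
      have := i.2
      have := j.1.2
      simp only [Fin.val_rev] at *
      omega
    · simp

theorem exists_scaling {U : ℤ → Submodule K V} (hind : iSupIndep U) (htop : ⨆ i, U i = ⊤)
    (c : ℤ → K) : ∃ T : End K V, ∀ i, ∀ x ∈ U i, T x = c i • x := by
  have hint := DirectSum.isInternal_submodule_of_iSupIndep_of_iSup_eq_top hind htop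
  let e := LinearEquiv.ofBijective (DirectSum.coeLinearMap U) hint
  refine ⟨(DirectSum.toModule K ℤ V fun i => c i • (U i).subtype) ∘ₗ e.symm.toLinearMap,
    fun i x hx => ?_⟩
  have : e.symm x = DirectSum.lof K ℤ (fun i => U i) i ⟨x, hx⟩ := by
    rw [LinearEquiv.symm_apply_eq]
    exact (DirectSum.coeLinearMap_lof U i ⟨x, hx⟩).symm
  simp [this]

theorem linearMap_ext_of_iSup {U : ℤ → Submodule K V} (htop : ⨆ i, U i = ⊤) {S T : End K V}
    (h : ∀ i, ∀ x ∈ U i, S x = T x) : S = T := by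
  have : (⊤ : Submodule K V) ≤ LinearMap.eqLocus S T := htop ▸ iSup_le fun i x hx => h i x hx
  exact LinearMap.ext fun x => this (Submodule.mem_top (x := x))

end Eigenvalues

/-! ### The bound for tridiagonal pairs. -/

section Bound

variable {K V : Type*} [Field K] [IsAlgClosed K] [AddCommGroup V] [Module K V]
  [FiniteDimensional K V] {d : ℕ} {A B : End K V} {E F : Fin (d + 1) → Submodule K V} {p a b : K}

theorem IsTridiagonalPair.finrank_le_choose (h : IsTridiagonalPair A B) (hp0 : p ≠ 0)
    (hp : ∀ n : ℕ, 0 < n → p ^ n ≠ 1) (hAB : QSerre p A B) (hBA : QSerre p B A)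
    (hE : IsStandardOrdering A B E) (hF : IsStandardOrdering B A F)
    (hEa : ∀ j : Fin (d + 1), E j = End.eigenspace A (a * p ^ (j : ℕ)))
    (hFb : ∀ j : Fin (d + 1), F j = End.eigenspace B (b * p⁻¹ ^ (j : ℕ))) (j : Fin (d + 1)) :
    finrank K (E j) ≤ d.choose j := by
  let U : ℤ → Submodule K V := fun i => splitSpace E F i i
  have hind : iSupIndep U := iSupIndep_splitSpace fun i j hij => h.splitSpace_eq_bot hE hF hij
  have htop : ⨆ i, U i = ⊤ := h.iSup_splitSpace_eq_top hE hF
  obtain ⟨κ, hκ⟩ := exists_scaling hind htop (fun i => p ^ i)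
  obtain ⟨κ', hκ'⟩ := exists_scaling hind htop (fun i => p⁻¹ ^ i)
  have hR : ∀ i, ∀ x ∈ U i, (A - a • κ) x ∈ U (i + 1) := by
    intro i x hx
    have := splitSpace_sub_mem (θ := fun i => a * p ^ i) hF (by simpa using hEa) hx
    simpa only [LinearMap.sub_apply, LinearMap.smul_apply, hκ i x hx, smul_smul] using this
  have hL : ∀ i, ∀ x ∈ U i, (B - b • κ') x ∈ U (i - 1) := by
    intro i x hx
    have := splitSpace_sub_mem' (η := fun i => b * p⁻¹ ^ i) hE (by simpa using hFb) hx
    simpa only [LinearMap.sub_apply, LinearMap.smul_apply, hκ' i x hx, smul_smul] using this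
  have hA : A = (A - a • κ) + a • κ := (sub_add_cancel _ _).symm
  have hB : B = (B - b • κ') + b • κ' := (sub_add_cancel _ _).symm
  generalize A - a • κ = R at hR hA
  generalize B - b • κ' = L at hL hB
  have hi : p⁻¹ ≠ 0 := inv_ne_zero hp0
  have hκκ' : κ * κ' = 1 := linearMap_ext_of_iSup htop fun i x hx => by
    rw [Module.End.mul_apply, hκ' i x hx, map_smul, hκ i x hx, smul_smul, inv_zpow,
      inv_mul_cancel₀ (zpow_ne_zero _ hp0), one_smul, Module.End.one_apply]
  have hκ'κ : κ' * κ = 1 := linearMap_ext_of_iSup htop fun i x hx => by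
    rw [Module.End.mul_apply, hκ i x hx, map_smul, hκ' i x hx, smul_smul, inv_zpow,
      mul_inv_cancel₀ (zpow_ne_zero _ hp0), one_smul, Module.End.one_apply]
  have hκR : κ * R = p • (R * κ) := linearMap_ext_of_iSup htop fun i x hx => by
    rw [Module.End.mul_apply, hκ _ _ (hR i x hx), LinearMap.smul_apply, Module.End.mul_apply,
      hκ i x hx, map_smul, smul_smul, zpow_add_one₀ hp0, mul_comm]
  have hκL : κ * L = p⁻¹ • (L * κ) := linearMap_ext_of_iSup htop fun i x hx => by
    rw [Module.End.mul_apply, hκ _ _ (hL i x hx), LinearMap.smul_apply, Module.End.mul_apply,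
      hκ i x hx, map_smul, smul_smul, zpow_sub_one₀ hp0, mul_comm]
  have hκ'R : κ' * R = p⁻¹ • (R * κ') := linearMap_ext_of_iSup htop fun i x hx => by
    rw [Module.End.mul_apply, hκ' _ _ (hR i x hx), LinearMap.smul_apply, Module.End.mul_apply,
      hκ' i x hx, map_smul, smul_smul, zpow_add_one₀ hi, mul_comm]
  have hκ'L : κ' * L = p • (L * κ') := linearMap_ext_of_iSup htop fun i x hx => by
    rw [Module.End.mul_apply, hκ' _ _ (hL i x hx), LinearMap.smul_apply, Module.End.mul_apply,
      hκ' i x hx, map_smul, smul_smul, zpow_sub_one₀ hi, inv_inv, mul_comm]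
  have hRL : QSerre p R L := QSerre.of_add hp0 a b hκκ' hκ'κ hκR hκL hκ'R (hA ▸ hB ▸ hAB)
  have hLR : QSerre p L R := QSerre.of_add hp0 b a hκ'κ hκκ' hκ'L hκ'R hκL (hA ▸ hB ▸ hBA)
  have hgraded : IsRaisingLowering d U R L :=
    ⟨hR, hL, fun i hi => eq_bot_iff.2 (inf_le_left.trans (downFlag_eq_bot hi).le),
      fun i hi => eq_bot_iff.2 (inf_le_right.trans (upFlag_eq_bot hi).le)⟩
  have hfin : ∀ j : Fin (d + 1), finrank K (U ((j : ℕ) : ℤ)) = finrank K (E j) :=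
    h.finrank_splitSpace hE hF
  rw [← hfin]
  refine hgraded.finrank_le_choose hp0 hp hRL hLR ?_ hind ?_ j
  · intro h0
    have h1 : finrank K (U 0) = finrank K (E 0) := hfin 0
    rw [h0, finrank_bot] at h1
    exact hE.ne_bot 0 (Submodule.finrank_eq_zero.1 h1.symm)
  · intro s hs hsR hsL hne
    have stable : ∀ T : End K V, (∀ x ∈ s, T x ∈ Submodule.span K s) →
        ∀ x ∈ Submodule.span K s, T x ∈ Submodule.span K s := by
      intro T hT
      have : Submodule.span K s ≤ (Submodule.span K s).comap T := Submodule.span_le.2 hT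
      exact fun x hx => this hx
    -- Since s consists of homogeneous vectors, κ and κ' preserve its span; stability under R and L
    -- then gives stability under A and B.
    have hκs : ∀ x ∈ s, κ x ∈ Submodule.span K s := fun x hx => by
      obtain ⟨i, hi⟩ := hs x hx
      rw [hκ i x hi]
      exact Submodule.smul_mem _ _ (Submodule.subset_span hx)
    have hκ's : ∀ x ∈ s, κ' x ∈ Submodule.span K s := fun x hx => by
      obtain ⟨i, hi⟩ := hs x hx
      rw [hκ' i x hi]
      exact Submodule.smul_mem _ _ (Submodule.subset_span hx)
    refine (h.eq_bot_or_eq_top ?_ ?_).resolve_left ?_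
    · rw [hA]
      exact stable _ fun x hx => Submodule.add_mem _ (hsR x hx)
        (Submodule.smul_mem _ _ (hκs x hx))
    · rw [hB]
      exact stable _ fun x hx => Submodule.add_mem _ (hsL x hx)
        (Submodule.smul_mem _ _ (hκ's x hx))
    · intro h0
      obtain ⟨x, hx, hx0⟩ := hne
      have := Submodule.subset_span (R := K) hx
      rw [h0] at this
      exact hx0 this

theorem eigenspace_comp_rev {K V : Type*} [Field K] [AddCommGroup V] [Module K V] {d : ℕ}
    {B : End K V} {F : Fin (d + 1) → Submodule K V} {p b : K} (hFb : ∀ j : Fin (d + 1), F j = End.eigenspace B (b * p ^ (j : ℕ)))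
    (hp0 : p ≠ 0) (j : Fin (d + 1)) :
    (F ∘ Fin.rev) j = End.eigenspace B (b * p ^ d * p⁻¹ ^ (j : ℕ)) := by
  rw [Function.comp_apply, hFb, mul_assoc, Fin.val_rev]
  congr 2
  obtain ⟨c, hc⟩ := Nat.exists_eq_add_of_le (Nat.lt_succ_iff.1 j.2)
  rw [show d + 1 - ((j : ℕ) + 1) = c by omega]
  generalize (j : ℕ) = m at hc
  rw [hc, pow_add, mul_right_comm, ← mul_pow, mul_inv_cancel₀ hp0, one_pow, one_mul]

theorem IsTridiagonalPair.finrank_le_choose_of_qSerre (h : IsTridiagonalPair A B) (hp0 : p ≠ 0)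
    (hp : ∀ n : ℕ, 0 < n → p ^ n ≠ 1) (hAB : QSerre p A B) (hBA : QSerre p B A)
    (hE : IsStandardOrdering A B E) (hF : IsStandardOrdering B A F) (j : Fin (d + 1)) :
    finrank K (E j) ≤ d.choose j := by
  obtain ⟨a, ha⟩ := h.exists_geometric hp0 hAB hE
  -- The q-Serre relations are symmetric under p ↔ p⁻¹, so E may be assumed to have ratio p; then F
  -- is reversed if its ratio is also p.
  wlog ha' : ∀ j : Fin (d + 1), E j = End.eigenspace A (a * p ^ (j : ℕ)) generalizing p
  · have ha'' := ha.resolve_left ha'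
    refine this (inv_ne_zero hp0) (fun n hn he => hp n hn ?_) hAB.inv hBA.inv ?_ ha''
    · rwa [inv_pow, inv_eq_one] at he
    · exact Or.inl ha''
  obtain ⟨b, hb | hb⟩ := h.swap.exists_geometric hp0 hBA hF
  · exact h.finrank_le_choose hp0 hp hAB hBA hE hF.rev ha' (eigenspace_comp_rev hb hp0) j
  · exact h.finrank_le_choose hp0 hp hAB hBA hE hF ha' hb j

end Bound

theorem TridiagonalRelations.qSerre {K V : Type*} [Field K] [AddCommGroup V] [Module K V]
    {A B : End K V} {p : K} (h : TridiagonalRelations A B (p + p⁻¹) 0 0 0 0) :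
    QSerre p A B ∧ QSerre p B A := by
  have key : ∀ x y : End K V, ⁅x, x ^ 2 * y - (p + p⁻¹) • (x * y * x) + y * x ^ 2 -
      (0 : K) • (x * y + y * x) - (0 : K) • y⁆ = 0 → QSerre p x y := by
    intro x y hxy
    rw [QSerre, ← hxy, Ring.lie_def]
    simp only [zero_smul, sub_zero, mul_add, add_mul, mul_sub, sub_mul, mul_smul_comm,
      smul_mul_assoc, pow_two, mul_assoc]
    module
  exact ⟨key A B h.1, key B A h.2⟩

end TridiagonalPair

theorem theorem1p6 {K V : Type*} [Field K] [IsAlgClosed K] [CharZero K]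
    [AddCommGroup V] [Module K V] [FiniteDimensional K V] [Nontrivial V]
    (q : K) (hq0 : q ≠ 0) (hq : ∀ n : ℕ, 0 < n → q ^ n ≠ 1)
    (A Astar : Module.End K V)
    (hpair : TridiagonalPair.IsTridiagonalPair A Astar)
    (hrel : TridiagonalPair.TridiagonalRelations A Astar (q ^ 2 + (q ^ 2)⁻¹) 0 0 0 0)
    (d δ : ℕ)
    (E : Fin (d + 1) → Submodule K V) (hE : TridiagonalPair.IsStandardOrdering A Astar E)
    (Estar : Fin (δ + 1) → Submodule K V)
    (hEstar : TridiagonalPair.IsStandardOrdering Astar A Estar) :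
    ∃ h : d = δ, ∃ ρ : Fin (d + 1) → ℕ,
      (∀ i : Fin (d + 1), Module.finrank K (E i) = ρ i ∧
        Module.finrank K (Estar (Fin.cast (congrArg (· + 1) h) i)) = ρ i) ∧
      ∀ i : Fin (d + 1), ρ i ≤ d.choose i := by
  obtain rfl : d = δ :=
    (hpair.diameter_le hE hEstar).antisymm (hpair.swap.diameter_le hEstar hE)
  obtain ⟨hAB, hBA⟩ := hrel.qSerre
  refine ⟨rfl, fun i => Module.finrank K (E i), fun i => ⟨rfl, hpair.finrank_eq hE hEstar i⟩, ?_⟩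
  refine hpair.finrank_le_choose_of_qSerre (pow_ne_zero 2 hq0) (fun n hn => ?_) hAB hBA hE hEstar
  rw [← pow_mul]
  exact hq (2 * n) (by omega)
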